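/- Let $d$ be a positive integer and $\mathcal A=\{0,1,\dots,d-1\}$. For an infinite word $\mathbf u=u_0u_1u_2\cdots$ over $\mathcal A$, a factor $w$ of $\mathbf u$ is left special (right special) if $aw$ and $bw$ (respectively $wa$ and $wb$) are factors of $\mathbf u$ for two distinct letters $a,b$, and bispecial if it is both. The word $\mathbf u$ is recurrent if each of its factors has at least two occurrences in $\mathbf u$. A recurrent word $\mathbf u$ is a $d$-ary Arnoux–Rauzy word if for every $n\ge 0$ it has exactly $(d-1)n+1$ factors of length $n$, of which exactly one is left special and exactly one is right special; it is standard if moreover each of its prefixes is left special. For $i\in\mathcal A$ let $\varphi_i$ be the morphism with $\varphi_i(i)=i$ and $\varphi_i(j)=ij$ for $j\ne i$. The directive sequence of a standard Arnoux–Rauzy word $\mathbf u$ is the sequence $(i_n)_{n\ge 0}$ of letters for which there are standard $d$-ary Arnoux–Rauzy words $\mathbf u^{(n)}$ with $\mathbf u^{(0)}=\mathbf u$ and $\mathbf u^{(n)}=\varphi_{i_n}(\mathbf u^{(n+1)})$ for all $n\ge 0$. The initial non-repetitive complexity of $\mathbf u$ is $$inr\mathcal C_{\mathbf u}(n)=\max\{m\in\mathbb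 N:\ u_p\cdots u_{p+n-1}\ne u_q\cdots u_{q+n-1}\ \text{ for all } 0\le p<q\le m-1\}.$$ Theorem. Let $\mathbf u$ be a standard $d$-ary Arnoux–Rauzy word with directive sequence $(i_n)_{n\ge0}$. The bispecial factors of $\mathbf u$ form an infinite sequence $B_{\mathbf u}(0),B_{\mathbf u}(1),B_{\mathbf u}(2),\dots$ with strictly increasing lengths. For every integer $n\ge 1$ there is a unique $k\ge 1$ such that $|B_{\mathbf u}(k-1)|<n\le|B_{\mathbf u}(k)|$, and for this $k$ the maximum defining $inr\mathcal C_{\mathbf u}(n)$ exists and $$inr\mathcal C_{\mathbf u}(n)=|\varphi_{i_0}\varphi_{i_1}\cdots\varphi_{i_{k-1}}(i_k)|.$$ Moreover, this value is the length of the first return word to the prefix $w$ of $\mathbf u$ of length $n$, i.e. of the word $u_pu_{p+1}\cdots u_{q-1}$, where $p<q$ are the first two occurrences of $w$ in $\mathbf u$. -/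

import Mathlib

namespace ArnouxRauzy

/-- The word `u_i u_{i+1} ⋯ u_{i+n-1}`, the factor of length `n` at position `i`. -/
def factorAt {A : Type*} (u : ℕ → A) (i n : ℕ) : List A :=
  (List.range n).map (fun j => u (i + j))

/-- The index `i` is an occurrence of `w` in `u`. -/
def IsOccurrence {A : Type*} (u : ℕ → A) (w : List A) (i : ℕ) : Prop :=
  factorAt u i w.length = w

/-- `w` belongs to the language of `u`. -/
def IsFactor {A : Type*} (u : ℕ → A) (w : List A) : Prop :=
  ∃ i, IsOccurrence u w i

def IsLeftSpecial {A : Type*} (u : ℕ → A) (w : List A) : Prop :=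
  ∃ a b : A, a ≠ b ∧ IsFactor u (a :: w) ∧ IsFactor u (b :: w)

def IsRightSpecial {A : Type*} (u : ℕ → A) (w : List A) : Prop :=
  ∃ a b : A, a ≠ b ∧ IsFactor u (w ++ [a]) ∧ IsFactor u (w ++ [b])

def IsBispecial {A : Type*} (u : ℕ → A) (w : List A) : Prop :=
  IsLeftSpecial u w ∧ IsRightSpecial u w

/-- Every factor has at least two occurrences. -/
def IsRecurrent {A : Type*} (u : ℕ → A) : Prop :=
  ∀ w, IsFactor u w → ∃ i j, i ≠ j ∧ IsOccurrence u w i ∧ IsOccurrence u w j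

/-- `d`-ary Arnoux–Rauzy words over the alphabet `{0, …, d-1}` (here `d` is automatically positive,
since there is no infinite word over the empty alphabet). -/
structure IsArnouxRauzy {d : ℕ} (u : ℕ → Fin d) : Prop where
  recurrent : IsRecurrent u
  card_factors : ∀ n, {w : List (Fin d) | IsFactor u w ∧ w.length = n}.ncard = (d - 1) * n + 1
  left_special : ∀ n, ∃! w : List (Fin d), w.length = n ∧ IsLeftSpecial u w
  right_special : ∀ n, ∃! w : List (Fin d), w.length = n ∧ IsRightSpecial u w

/-- An Arnoux–Rauzy word is standard if each of its prefixes is left special. -/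
structure IsStandardArnouxRauzy {d : ℕ} (u : ℕ → Fin d) : Prop extends IsArnouxRauzy u where
  prefix_left_special : ∀ n, IsLeftSpecial u (factorAt u 0 n)

/-- The elementary morphism `φ_i` on letters: `i ↦ i` and `j ↦ ij` for `j ≠ i`. -/
def elementaryLetter {d : ℕ} (i j : Fin d) : List (Fin d) :=
  if j = i then [i] else [i, j]

/-- The elementary morphism `φ_i` on finite words. -/
def elementary {d : ℕ} (i : Fin d) (w : List (Fin d)) : List (Fin d) :=
  w.flatMap (elementaryLetter i)

/-- `v = φ_i(u)` for infinite words: `v = φ_i(u_0) φ_i(u_1) φ_i(u_2) ⋯`, that is, the image of every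
prefix of `u` is a prefix of `v`. As images of letters are nonempty, this determines `v`. -/
def IsElementaryImage {d : ℕ} (i : Fin d) (u v : ℕ → Fin d) : Prop :=
  ∀ n, IsOccurrence v (elementary i (factorAt u 0 n)) 0

/-- `(i_n)` is the directive sequence of `u`: there are standard Arnoux–Rauzy words `u^{(n)}` with
`u = u^{(0)}` and `u^{(n)} = φ_{i_n}(u^{(n+1)})` for all `n`. -/
def IsDirectiveSequence {d : ℕ} (u : ℕ → Fin d) (i : ℕ → Fin d) : Prop :=
  ∃ U : ℕ → ℕ → Fin d, U 0 = u ∧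
    ∀ n, IsStandardArnouxRauzy (U n) ∧ IsElementaryImage (i n) (U (n + 1)) (U n)

/-- The composition `φ_{i_0} φ_{i_1} ⋯ φ_{i_{k-1}}` applied to a finite word. -/
def directiveMorphism {d : ℕ} (i : ℕ → Fin d) : ℕ → List (Fin d) → List (Fin d)
  | 0, w => w
  | k + 1, w => directiveMorphism i k (elementary (i k) w)

/-- `B 0, B 1, B 2, …` are all the bispecial factors of `u`, ordered by (strictly increasing)
length. There is at most one such `B`. -/
structure IsBispecialEnumeration {A : Type*} (u : ℕ → A) (B : ℕ → List A) : Prop where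
  strictMono_length : StrictMono (fun k => (B k).length)
  range_eq : Set.range B = {w | IsBispecial u w}

/-- The numbers `m` such that the factors of length `n` at positions `0, …, m-1` are pairwise
distinct. -/
def initialNonRepetitive {A : Type*} (u : ℕ → A) (n : ℕ) : Set ℕ :=
  {m | ∀ i j, i < j → j < m → factorAt u i n ≠ factorAt u j n}

/-- The initial non-repetitive complexity, the maximum of the above set. -/
noncomputable def inrC {A : Type*} (u : ℕ → A) (n : ℕ) : ℕ :=
  sSup (initialNonRepetitive u n)

/-- `i < j` are two consecutive occurrences of `w` in `u`. -/
def ConsecutiveOccurrences {A : Type*} (u : ℕ → A) (w : List A) (i j : ℕ) : Prop :=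
  i < j ∧ IsOccurrence u w i ∧ IsOccurrence u w j ∧ ∀ l, i < l → l < j → ¬ IsOccurrence u w l

/-- `r` is the first return word to `w` in `u`: the word `u_i ⋯ u_{j-1}` where `i < j` are the first
two occurrences of `w` in `u`. -/
def IsFirstReturnWord {A : Type*} (u : ℕ → A) (w r : List A) : Prop :=
  ∃ i j, ConsecutiveOccurrences u w i j ∧ (∀ l, l < i → ¬ IsOccurrence u w l) ∧
    r = factorAt u i (j - i)

end ArnouxRauzy

/-! Left special factors of a standard word are its prefixes, so sliding two equal windows left
until the preceding letters differ exhibits a repeated prefix: `inrC u n` is the second occurrence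
of the length-`n` prefix (`isGreatest_initialNonRepetitive`). A prefix with length strictly between
consecutive bispecial lengths is not right special, so its occurrences are those of the next
bispecial factor (`isOccurrence_bispecialWord_of_prefix`). If `u = φ_a(v)`, the nonempty bispecial
factors of `u` are the `φ_a(w)a` with `w` bispecial in `v`, and occurrences correspond through
`blockStart`. After `k` desubstitutions the `k`-th one becomes the empty word, which recurs at
position 1, the length of `i_k`; mapping back gives the formula
(`consecutiveOccurrences_bispecialWord`). -/

namespace ArnouxRauzy

/-! ### Occurrences and repeated windows. -/

section Words

variable {A : Type*} {u : ℕ → A}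

@[simp] theorem length_factorAt (u : ℕ → A) (p n : ℕ) : (factorAt u p n).length = n := by
  simp [factorAt]

theorem factorAt_succ (u : ℕ → A) (p n : ℕ) :
    factorAt u p (n + 1) = factorAt u p n ++ [u (p + n)] := by
  simp [factorAt, List.range_succ]

theorem factorAt_add (u : ℕ → A) (p m n : ℕ) :
    factorAt u p (m + n) = factorAt u p m ++ factorAt u (p + m) n := by
  induction n with
  | zero => simp [factorAt]
  | succ n ih => rw [← Nat.add_assoc, factorAt_succ, ih, factorAt_succ]; simp [Nat.add_assoc]

theorem factorAt_one (u : ℕ → A) (p : ℕ) : factorAt u p 1 = [u p] := by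
  simp [factorAt]

theorem isOccurrence_nil (u : ℕ → A) (p : ℕ) : IsOccurrence u [] p := by
  simp [IsOccurrence, factorAt]

theorem isOccurrence_append (w w' : List A) (p : ℕ) :
    IsOccurrence u (w ++ w') p ↔ IsOccurrence u w p ∧ IsOccurrence u w' (p + w.length) := by
  unfold IsOccurrence
  rw [List.length_append, factorAt_add]
  refine ⟨fun h => List.append_inj h (by simp), fun h => ?_⟩
  rw [h.1, h.2]

theorem isOccurrence_singleton (x : A) (p : ℕ) : IsOccurrence u [x] p ↔ u p = x := by
  simp [IsOccurrence, factorAt]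

theorem isOccurrence_cons (x : A) (w : List A) (p : ℕ) :
    IsOccurrence u (x :: w) p ↔ u p = x ∧ IsOccurrence u w (p + 1) := by
  rw [← List.singleton_append, isOccurrence_append, isOccurrence_singleton]; rfl

theorem isOccurrence_concat (w : List A) (x : A) (p : ℕ) :
    IsOccurrence u (w ++ [x]) p ↔ IsOccurrence u w p ∧ u (p + w.length) = x := by
  rw [isOccurrence_append, isOccurrence_singleton]

theorem isOccurrence_factorAt (u : ℕ → A) (p q n : ℕ) :
    IsOccurrence u (factorAt u p n) q ↔ factorAt u q n = factorAt u p n := by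
  simp [IsOccurrence]

/-- If the left special factors are the prefixes, the first repeated factor is the prefix. -/
theorem isGreatest_initialNonRepetitive {n R : ℕ}
    (hls : ∀ w, w.length = n → IsLeftSpecial u w → w = factorAt u 0 n)
    (hR : ConsecutiveOccurrences u (factorAt u 0 n) 0 R) :
    IsGreatest (initialNonRepetitive u n) R := by
  obtain ⟨h0, -, hocc, hmin⟩ := hR
  simp only [isOccurrence_factorAt] at hocc hmin
  refine ⟨?_, fun m hm => ?_⟩
  · intro p
    induction p with
    | zero => exact fun q hq hqR h => hmin q hq hqR h.symm
    | succ p ih =>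
      intro q hpq hqR h
      obtain ⟨q, rfl⟩ : ∃ r, q = r + 1 := ⟨q - 1, by omega⟩
      -- Equal preceding letters let both windows slide left; distinct ones make the window left
      -- special, hence a prefix recurring at `p + 1 < R`.
      by_cases hx : u p = u q
      · refine ih q (by omega) (by omega) ?_
        have key : factorAt u p (1 + n) = factorAt u q (1 + n) := by
          rw [factorAt_add, factorAt_add, h, factorAt_one, factorAt_one, hx]
        rw [Nat.add_comm, factorAt_succ, factorAt_succ] at key
        exact (List.append_inj key (by simp)).1
      · refine hmin (p + 1) (by omega) (by omega) (hls _ (by simp) ⟨u p, u q, hx, ⟨p, ?_⟩, q, ?_⟩)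
        · rw [isOccurrence_cons, isOccurrence_factorAt]; exact ⟨rfl, rfl⟩
        · rw [isOccurrence_cons, isOccurrence_factorAt]; exact ⟨rfl, h.symm⟩
  · by_contra hlt
    exact hm 0 R h0 (by omega) hocc.symm

end Words

variable {d : ℕ}

/-! ### Desubstitution of one elementary morphism. -/

section Elementary

variable {a : Fin d} {u v : ℕ → Fin d}

theorem elementary_cons (a x : Fin d) (w : List (Fin d)) :
    elementary a (x :: w) = elementaryLetter a x ++ elementary a w := by
  simp [elementary]

theorem elementary_append (a : Fin d) (w w' : List (Fin d)) :
    elementary a (w ++ w') = elementary a w ++ elementary a w' := by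
  simp [elementary]

theorem elementary_singleton (a x : Fin d) : elementary a [x] = elementaryLetter a x := by
  simp [elementary]

theorem length_le_length_elementary (a : Fin d) (w : List (Fin d)) :
    w.length ≤ (elementary a w).length := by
  induction w with
  | nil => simp
  | cons x w ih =>
    rw [elementary_cons, List.length_append, List.length_cons]
    have : 1 ≤ (elementaryLetter a x).length := by unfold elementaryLetter; split <;> simp
    omega

/-- The position in `φ_a(v)` at which the image of the letter `v_m` begins. -/
def blockStart (a : Fin d) (v : ℕ → Fin d) (m : ℕ) : ℕ :=
  (elementary a (factorAt v 0 m)).length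

@[simp] theorem blockStart_zero (a : Fin d) (v : ℕ → Fin d) : blockStart a v 0 = 0 := by
  simp [blockStart, factorAt, elementary]

theorem blockStart_succ (a : Fin d) (v : ℕ → Fin d) (m : ℕ) :
    blockStart a v (m + 1) = blockStart a v m + (elementaryLetter a (v m)).length := by
  simp [blockStart, factorAt_succ, elementary_append, elementary_singleton]

theorem blockStart_succ_of_eq {m : ℕ} (h : v m = a) :
    blockStart a v (m + 1) = blockStart a v m + 1 := by
  simp [blockStart_succ, elementaryLetter, h]

theorem blockStart_succ_of_ne {m : ℕ} (h : v m ≠ a) :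
    blockStart a v (m + 1) = blockStart a v m + 2 := by
  simp [blockStart_succ, elementaryLetter, h]

theorem blockStart_strictMono (a : Fin d) (v : ℕ → Fin d) : StrictMono (blockStart a v) := by
  refine strictMono_nat_of_lt_succ fun m => ?_
  by_cases h : v m = a
  · simp [blockStart_succ_of_eq h]
  · simp [blockStart_succ_of_ne h]

theorem IsElementaryImage.isOccurrence_letter (h : IsElementaryImage a v u) (m : ℕ) :
    IsOccurrence u (elementaryLetter a (v m)) (blockStart a v m) := by
  have := h (m + 1)
  rw [factorAt_succ, elementary_append, elementary_singleton, isOccurrence_append] at this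
  simpa [blockStart] using this.2

theorem IsElementaryImage.apply_blockStart (h : IsElementaryImage a v u) (m : ℕ) :
    u (blockStart a v m) = a := by
  have := h.isOccurrence_letter m
  unfold elementaryLetter at this
  split at this
  · rwa [isOccurrence_singleton] at this
  · exact ((isOccurrence_cons _ _ _).1 this).1

/-- Also true for the one-letter block: the next letter is then the `a` that opens the following
block. -/
theorem IsElementaryImage.apply_blockStart_add_one (h : IsElementaryImage a v u) (m : ℕ) :
    u (blockStart a v m + 1) = v m := by
  by_cases hm : v m = a
  · rw [← blockStart_succ_of_eq hm, h.apply_blockStart, hm]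
  · have := h.isOccurrence_letter m
    rw [elementaryLetter, if_neg hm, isOccurrence_cons, isOccurrence_singleton] at this
    exact this.2

theorem exists_blockStart_eq (a : Fin d) (v : ℕ → Fin d) (p : ℕ) :
    (∃ m, p = blockStart a v m) ∨ ∃ m, v m ≠ a ∧ p = blockStart a v m + 1 := by
  induction p with
  | zero => exact .inl ⟨0, by simp⟩
  | succ p ih =>
    rcases ih with ⟨m, rfl⟩ | ⟨m, hm, rfl⟩
    · by_cases hm : v m = a
      · exact .inl ⟨m + 1, (blockStart_succ_of_eq hm).symm⟩
      · exact .inr ⟨m, hm, rfl⟩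
    · exact .inl ⟨m + 1, (blockStart_succ_of_ne hm).symm⟩

theorem IsElementaryImage.exists_blockStart_of_apply_eq (h : IsElementaryImage a v u) {p : ℕ}
    (hp : u p = a) : ∃ m, p = blockStart a v m := by
  rcases exists_blockStart_eq a v p with hm | ⟨m, hm, rfl⟩
  · exact hm
  · exact absurd (h.apply_blockStart_add_one m ▸ hp) hm

theorem IsElementaryImage.apply_add_one_of_ne (h : IsElementaryImage a v u) {p : ℕ}
    (hp : u p ≠ a) : u (p + 1) = a := by
  rcases exists_blockStart_eq a v p with ⟨m, rfl⟩ | ⟨m, hm, rfl⟩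
  · exact absurd (h.apply_blockStart m) hp
  · rw [Nat.add_assoc, ← blockStart_succ_of_ne hm, h.apply_blockStart]

/-- The words `φ_a(w)a` begin with `a`. -/
theorem exists_elementary_concat_eq_cons (a : Fin d) (w : List (Fin d)) :
    ∃ t, elementary a w ++ [a] = a :: t := by
  cases w with
  | nil => exact ⟨[], by simp [elementary]⟩
  | cons x w =>
    rw [elementary_cons]
    unfold elementaryLetter
    split
    · exact ⟨_, rfl⟩
    · exact ⟨_, rfl⟩

theorem apply_eq_of_isOccurrence_elementary_concat {w : List (Fin d)} {p : ℕ}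
    (h : IsOccurrence u (elementary a w ++ [a]) p) : u p = a := by
  obtain ⟨t, ht⟩ := exists_elementary_concat_eq_cons a w
  rw [ht, isOccurrence_cons] at h
  exact h.1

theorem IsElementaryImage.isOccurrence_blockStart_iff (h : IsElementaryImage a v u)
    (w : List (Fin d)) (m : ℕ) :
    IsOccurrence u (elementary a w ++ [a]) (blockStart a v m) ↔ IsOccurrence v w m := by
  induction w generalizing m with
  | nil =>
    simpa [elementary, isOccurrence_singleton, h.apply_blockStart] using isOccurrence_nil v m
  | cons x w ih =>
    rw [elementary_cons, List.append_assoc, isOccurrence_cons]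
    by_cases hx : x = a
    · rw [elementaryLetter, if_pos hx, List.singleton_append, isOccurrence_cons,
        ← ih (m + 1), hx]
      constructor
      · rintro ⟨-, h2⟩
        -- The trailing `a` guarantees that the rest starts with `a`, even for empty `w`, which
        -- rules out a two-letter block here.
        have hm : v m = a := by
          rw [← h.apply_blockStart_add_one]
          exact apply_eq_of_isOccurrence_elementary_concat h2
        rw [blockStart_succ_of_eq hm]
        exact ⟨hm, h2⟩
      · rintro ⟨hm, h2⟩
        rw [blockStart_succ_of_eq hm] at h2
        exact ⟨h.apply_blockStart m, h2⟩
    · rw [elementaryLetter, if_neg hx, List.cons_append, List.singleton_append, isOccurrence_cons,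
        isOccurrence_cons, ← ih (m + 1), h.apply_blockStart_add_one]
      simp only [h.apply_blockStart, true_and]
      refine and_congr_right fun hm => ?_
      rw [blockStart_succ_of_ne (hm ▸ hx)]

theorem IsElementaryImage.isOccurrence_iff (h : IsElementaryImage a v u)
    (w : List (Fin d)) (p : ℕ) :
    IsOccurrence u (elementary a w ++ [a]) p ↔
      ∃ m, p = blockStart a v m ∧ IsOccurrence v w m := by
  constructor
  · intro hp
    obtain ⟨m, rfl⟩ := h.exists_blockStart_of_apply_eq
      (apply_eq_of_isOccurrence_elementary_concat hp)
    exact ⟨m, rfl, (h.isOccurrence_blockStart_iff w m).1 hp⟩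
  · rintro ⟨m, rfl, hm⟩
    exact (h.isOccurrence_blockStart_iff w m).2 hm

theorem blockStart_add_of_isOccurrence {w : List (Fin d)} {m : ℕ} (hw : IsOccurrence v w m) :
    blockStart a v (m + w.length) = blockStart a v m + (elementary a w).length := by
  unfold blockStart
  rw [factorAt_add, elementary_append, List.length_append, Nat.zero_add, hw]

/-- The final `a` opens the block of the letter following `w` in `v`, and the letter after a block
start is always that letter. -/
theorem IsElementaryImage.isFactor_concat_iff (h : IsElementaryImage a v u)
    (w : List (Fin d)) (x : Fin d) :
    IsFactor u (elementary a w ++ [a] ++ [x]) ↔ IsFactor v (w ++ [x]) := by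
  have key : ∀ m, IsOccurrence v w m →
      u (blockStart a v m + (elementary a w ++ [a]).length) = v (m + w.length) := fun m hm => by
    rw [← h.apply_blockStart_add_one, blockStart_add_of_isOccurrence hm]
    simp [Nat.add_assoc]
  constructor
  · rintro ⟨p, hp⟩
    rw [isOccurrence_concat, h.isOccurrence_iff] at hp
    obtain ⟨⟨m, rfl, hm⟩, hx⟩ := hp
    exact ⟨m, (isOccurrence_concat _ _ _).2 ⟨hm, (key m hm) ▸ hx⟩⟩
  · rintro ⟨m, hm⟩
    rw [isOccurrence_concat] at hm
    exact ⟨blockStart a v m, (isOccurrence_concat _ _ _).2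
      ⟨(h.isOccurrence_blockStart_iff w m).2 hm.1, (key m hm.1).trans hm.2⟩⟩

theorem IsElementaryImage.isRightSpecial_iff (h : IsElementaryImage a v u) (w : List (Fin d)) :
    IsRightSpecial u (elementary a w ++ [a]) ↔ IsRightSpecial v w := by
  simp only [IsRightSpecial, h.isFactor_concat_iff]

theorem IsElementaryImage.eq_of_isRightSpecial_concat (h : IsElementaryImage a v u)
    {w : List (Fin d)} {x : Fin d} (hw : IsRightSpecial u (w ++ [x])) : x = a := by
  by_contra hx
  obtain ⟨b, c, hbc, ⟨p, hp⟩, q, hq⟩ := hw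
  have key : ∀ p y, IsOccurrence u (w ++ [x] ++ [y]) p → y = a := fun p y hp => by
    rw [isOccurrence_concat, isOccurrence_concat, List.length_append, ← Nat.add_assoc] at hp
    rw [← hp.2]
    exact h.apply_add_one_of_ne (hp.1.2 ▸ hx)
  exact hbc ((key p b hp).trans (key q c hq).symm)

/-- The nonempty prefixes of `φ_a(v)` ending in `a` are the words `φ_a(w)a` for the prefixes `w`
of `v`. -/
theorem IsElementaryImage.exists_prefix_eq (h : IsElementaryImage a v u) {n : ℕ}
    (hn : u n = a) :
    ∃ m, factorAt u 0 (n + 1) = elementary a (factorAt v 0 m) ++ [a] := by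
  obtain ⟨m, rfl⟩ := h.exists_blockStart_of_apply_eq hn
  refine ⟨m, ?_⟩
  rw [factorAt_succ, Nat.zero_add, hn]
  exact congrArg (· ++ [a]) (h m)

end Elementary

/-! ### Bispecial factors under an elementary morphism. -/

section Standard

variable {a : Fin d} {u v : ℕ → Fin d}

theorem IsStandardArnouxRauzy.eq_prefix (hu : IsStandardArnouxRauzy u) {w : List (Fin d)} {n : ℕ}
    (hn : w.length = n) (hw : IsLeftSpecial u w) : w = factorAt u 0 n :=
  (hu.left_special n).unique ⟨hn, hw⟩ ⟨by simp, hu.prefix_left_special n⟩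

theorem IsStandardArnouxRauzy.isBispecial_nil (hu : IsStandardArnouxRauzy u) :
    IsBispecial u [] := by
  refine ⟨hu.prefix_left_special 0, ?_⟩
  obtain ⟨w, ⟨hw, h⟩, -⟩ := hu.right_special 0
  rwa [List.length_eq_zero_iff.1 hw] at h

theorem IsStandardArnouxRauzy.isBispecial_elementary_concat (hu : IsStandardArnouxRauzy u)
    (hv : IsStandardArnouxRauzy v) (h : IsElementaryImage a v u) {w : List (Fin d)}
    (hw : IsBispecial v w) : IsBispecial u (elementary a w ++ [a]) := by
  refine ⟨?_, (h.isRightSpecial_iff w).2 hw.2⟩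
  -- Left specialness comes for free once the word is a prefix.
  have h0 : IsOccurrence u (elementary a w ++ [a]) 0 := by
    rw [h.isOccurrence_iff]
    exact ⟨0, by simp, (hv.eq_prefix rfl hw.1).symm⟩
  rw [← h0]
  exact hu.prefix_left_special _

theorem IsStandardArnouxRauzy.exists_of_isBispecial (hu : IsStandardArnouxRauzy u)
    (hv : IsStandardArnouxRauzy v) (h : IsElementaryImage a v u) {w : List (Fin d)}
    (hw : IsBispecial u w) (hne : w ≠ []) :
    ∃ w', IsBispecial v w' ∧ w = elementary a w' ++ [a] := by
  obtain ⟨t, x, rfl⟩ := (List.eq_nil_or_concat w).resolve_left hne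
  rw [List.concat_eq_append] at hw ⊢
  obtain rfl := h.eq_of_isRightSpecial_concat hw.2
  have hp := hu.eq_prefix (n := t.length + 1) (by simp) hw.1
  have hx : u t.length = x := by
    rw [factorAt_succ, Nat.zero_add] at hp
    simpa using (List.append_inj hp (by simp)).2.symm
  obtain ⟨m, hm⟩ := h.exists_prefix_eq hx
  rw [hp, hm] at hw ⊢
  exact ⟨_, ⟨hv.prefix_left_special m, (h.isRightSpecial_iff _).1 hw.2⟩, rfl⟩

end Standard

/-! ### Iteration along the directive sequence. -/

section Directive

variable {u : ℕ → Fin d} {i : ℕ → Fin d}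

theorem IsDirectiveSequence.isStandard (h : IsDirectiveSequence u i) :
    IsStandardArnouxRauzy u := by
  obtain ⟨U, rfl, hU⟩ := h
  exact (hU 0).1

theorem IsDirectiveSequence.exists_desubstitution (h : IsDirectiveSequence u i) :
    ∃ v, IsElementaryImage (i 0) v u ∧ IsDirectiveSequence v (fun n => i (n + 1)) := by
  obtain ⟨U, rfl, hU⟩ := h
  exact ⟨U 1, (hU 0).2, fun n => U (n + 1), rfl, fun n => hU (n + 1)⟩

/-- The definition peels off the innermost morphism; desubstituting `u` needs the outermost. -/
theorem directiveMorphism_succ' (i : ℕ → Fin d) (k : ℕ) (w : List (Fin d)) :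
    directiveMorphism i (k + 1) w =
      elementary (i 0) (directiveMorphism (fun n => i (n + 1)) k w) := by
  induction k generalizing w with
  | zero => rfl
  | succ k ih => rw [directiveMorphism, ih]; rfl

/-- The bispecial factors of the standard Arnoux–Rauzy word with directive sequence `i`. -/
def bispecialWord : (ℕ → Fin d) → ℕ → List (Fin d)
  | _, 0 => []
  | i, k + 1 => elementary (i 0) (bispecialWord (fun n => i (n + 1)) k) ++ [i 0]

theorem IsDirectiveSequence.isBispecial_bispecialWord (h : IsDirectiveSequence u i) (k : ℕ) :
    IsBispecial u (bispecialWord i k) := by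
  induction k generalizing u i with
  | zero => exact h.isStandard.isBispecial_nil
  | succ k ih =>
    obtain ⟨v, hv, hd⟩ := h.exists_desubstitution
    exact h.isStandard.isBispecial_elementary_concat hd.isStandard hv (ih hd)

theorem IsDirectiveSequence.bispecialWord_eq_prefix (h : IsDirectiveSequence u i) (k : ℕ) :
    bispecialWord i k = factorAt u 0 (bispecialWord i k).length :=
  h.isStandard.eq_prefix rfl (h.isBispecial_bispecialWord k).1

theorem IsDirectiveSequence.exists_bispecialWord_eq (h : IsDirectiveSequence u i)
    {w : List (Fin d)} (hw : IsBispecial u w) : ∃ k, bispecialWord i k = w := by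
  induction hn : w.length using Nat.strong_induction_on generalizing u i w with
  | _ n ih =>
    by_cases hne : w = []
    · exact ⟨0, hne.symm⟩
    · obtain ⟨v, hv, hd⟩ := h.exists_desubstitution
      obtain ⟨w', hw', rfl⟩ := h.isStandard.exists_of_isBispecial hd.isStandard hv hw hne
      have hlen := length_le_length_elementary (i 0) w'
      rw [List.length_append, List.length_singleton] at hn
      obtain ⟨k, rfl⟩ := ih w'.length (by omega) hd hw' rfl
      exact ⟨k + 1, rfl⟩

theorem IsDirectiveSequence.length_bispecialWord_lt (h : IsDirectiveSequence u i) (k : ℕ) :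
    (bispecialWord i k).length < (bispecialWord i (k + 1)).length := by
  induction k generalizing u i with
  | zero => simp [bispecialWord]
  | succ k ih =>
    obtain ⟨v, hv, hd⟩ := h.exists_desubstitution
    rw [bispecialWord, bispecialWord, List.length_append, List.length_append,
      hd.bispecialWord_eq_prefix k, hd.bispecialWord_eq_prefix (k + 1)]
    exact Nat.add_lt_add_right (blockStart_strictMono (i 0) v (ih hd)) _

theorem IsDirectiveSequence.isBispecialEnumeration (h : IsDirectiveSequence u i) :
    IsBispecialEnumeration u (bispecialWord i) where
  strictMono_length := strictMono_nat_of_lt_succ h.length_bispecialWord_lt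
  range_eq := by
    ext w
    refine ⟨?_, h.exists_bispecialWord_eq⟩
    rintro ⟨k, rfl⟩
    exact h.isBispecial_bispecialWord k

theorem IsBispecialEnumeration.length_unique {A : Type*} {u : ℕ → A} {B C : ℕ → List A}
    (hB : IsBispecialEnumeration u B) (hC : IsBispecialEnumeration u C) (k : ℕ) :
    (B k).length = (C k).length := by
  have : (fun k => (B k).length) = fun k => (C k).length := by
    rw [← hB.strictMono_length.range_inj hC.strictMono_length]
    have := hB.range_eq.trans hC.range_eq.symm
    simpa only [← Set.range_comp, Function.comp_def] using congrArg (Set.image List.length) this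
  exact congrFun this k

theorem IsDirectiveSequence.apply_zero (h : IsDirectiveSequence u i) : u 0 = i 0 := by
  obtain ⟨v, hv, -⟩ := h.exists_desubstitution
  simpa using hv.apply_blockStart 0

/-- Being a prefix lets the length of its image be read as a `blockStart`. -/
theorem IsDirectiveSequence.isOccurrence_directiveMorphism (h : IsDirectiveSequence u i) (k : ℕ) :
    IsOccurrence u (directiveMorphism i k [i k]) 0 := by
  induction k generalizing u i with
  | zero => exact (isOccurrence_singleton _ _).2 h.apply_zero
  | succ k ih =>
    obtain ⟨v, hv, hd⟩ := h.exists_desubstitution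
    rw [directiveMorphism_succ', ← ih hd]
    exact hv _

theorem IsDirectiveSequence.consecutiveOccurrences_bispecialWord (h : IsDirectiveSequence u i)
    (k : ℕ) :
    ConsecutiveOccurrences u (bispecialWord i k) 0 (directiveMorphism i k [i k]).length := by
  induction k generalizing u i with
  | zero =>
    refine ⟨by simp [directiveMorphism], isOccurrence_nil _ _, isOccurrence_nil _ _, ?_⟩
    intro l h0 h1
    simp only [directiveMorphism, List.length_singleton] at h1
    omega
  | succ k ih =>
    obtain ⟨v, hv, hd⟩ := h.exists_desubstitution
    obtain ⟨hpos, h0, h1, hmin⟩ := ih hd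
    have hlen : (directiveMorphism i (k + 1) [i (k + 1)]).length =
        blockStart (i 0) v (directiveMorphism (fun n => i (n + 1)) k [i (k + 1)]).length := by
      rw [directiveMorphism_succ', blockStart, hd.isOccurrence_directiveMorphism k]
    have hmono := blockStart_strictMono (i 0) v
    rw [hlen]
    refine ⟨by simpa using hmono hpos, (hv.isOccurrence_iff _ _).2 ⟨0, by simp, h0⟩,
      (hv.isOccurrence_iff _ _).2 ⟨_, rfl, h1⟩, fun l hl0 hl1 hl => ?_⟩
    obtain ⟨m, rfl, hm⟩ := (hv.isOccurrence_iff _ _).1 hl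
    refine hmin m ?_ (hmono.lt_iff_lt.1 hl1) hm
    exact hmono.lt_iff_lt.1 (by simpa using hl0)

/-- Between the lengths of two consecutive bispecial factors, every occurrence of a prefix extends
to an occurrence of the longer bispecial factor. -/
theorem IsDirectiveSequence.isOccurrence_bispecialWord_of_prefix (h : IsDirectiveSequence u i)
    {k n p : ℕ} (h1 : (bispecialWord i k).length < n)
    (h2 : n ≤ (bispecialWord i (k + 1)).length) (hp : factorAt u p n = factorAt u 0 n) :
    IsOccurrence u (bispecialWord i (k + 1)) p := by
  have key : ∀ m, n ≤ m → m ≤ (bispecialWord i (k + 1)).length →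
      factorAt u p m = factorAt u 0 m := by
    intro m hm
    induction m, hm using Nat.le_induction with
    | base => exact fun _ => hp
    | succ m hm ih =>
      intro hle
      specialize ih (by omega)
      rw [factorAt_succ, factorAt_succ, ih]
      by_contra hne
      have hx : u (p + m) ≠ u (0 + m) := fun hx => hne (by rw [hx])
      -- Two different continuations make this prefix bispecial, with length strictly between two
      -- consecutive bispecial lengths.
      have hrs : IsRightSpecial u (factorAt u 0 m) := by
        refine ⟨_, _, hx, ⟨p, ?_⟩, 0, ?_⟩
        · rw [isOccurrence_concat, isOccurrence_factorAt, length_factorAt]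
          exact ⟨ih, rfl⟩
        · rw [isOccurrence_concat, isOccurrence_factorAt, length_factorAt]
          exact ⟨rfl, rfl⟩
      obtain ⟨j, hj⟩ := h.exists_bispecialWord_eq ⟨h.isStandard.prefix_left_special m, hrs⟩
      have hjm : (bispecialWord i j).length = m := by rw [hj, length_factorAt]
      have hmono := h.isBispecialEnumeration.strictMono_length
      have hkj : k < j := hmono.lt_iff_lt.1 (by omega)
      have hjk : j < k + 1 := hmono.lt_iff_lt.1 (by omega)
      omega
  rw [IsOccurrence, key _ h2 le_rfl]
  exact (h.bispecialWord_eq_prefix (k + 1)).symm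

theorem IsDirectiveSequence.consecutiveOccurrences_prefix (h : IsDirectiveSequence u i)
    {k n : ℕ} (h1 : (bispecialWord i k).length < n)
    (h2 : n ≤ (bispecialWord i (k + 1)).length) :
    ConsecutiveOccurrences u (factorAt u 0 n) 0
      (directiveMorphism i (k + 1) [i (k + 1)]).length := by
  obtain ⟨hpos, -, hocc, hmin⟩ := h.consecutiveOccurrences_bispecialWord (k + 1)
  refine ⟨hpos, by simp [isOccurrence_factorAt], ?_, fun l hl0 hl1 hl => hmin l hl0 hl1 ?_⟩
  · obtain ⟨c, hc⟩ := Nat.exists_eq_add_of_le h2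
    have hB := h.bispecialWord_eq_prefix (k + 1)
    rw [hB, isOccurrence_factorAt, hc, factorAt_add, factorAt_add] at hocc
    rw [isOccurrence_factorAt]
    exact (List.append_inj hocc (by simp)).1
  · exact h.isOccurrence_bispecialWord_of_prefix h1 h2 ((isOccurrence_factorAt _ _ _ _).1 hl)

end Directive

/-! ### Locating `n`, and the theorem. -/

theorem existsUnique_between_of_strictMono {f : ℕ → ℕ} (hf : StrictMono f) (h0 : f 0 = 0) {n : ℕ}
    (hn : 1 ≤ n) : ∃! k, 1 ≤ k ∧ f (k - 1) < n ∧ n ≤ f k := by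
  have hex : ∃ k, n ≤ f k := ⟨n, hf.le_apply⟩
  have hk : 1 ≤ Nat.find hex := by
    by_contra hlt
    have := Nat.find_spec hex
    rw [show Nat.find hex = 0 by omega] at this
    omega
  refine ⟨Nat.find hex, ⟨hk, ?_, Nat.find_spec hex⟩, ?_⟩
  · exact not_le.1 (Nat.find_min hex (by omega))
  · rintro k ⟨hk1, hlt, hle⟩
    refine le_antisymm ?_ (Nat.find_min' hex hle)
    have := hf.lt_iff_lt.1 (hlt.trans_le (Nat.find_spec hex))
    omega

end ArnouxRauzy

theorem theorem15 {d : ℕ} (u : ℕ → Fin d) (i : ℕ → Fin d)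
    (hu : ArnouxRauzy.IsStandardArnouxRauzy u)
    (hi : ArnouxRauzy.IsDirectiveSequence u i) :
    (∃ B : ℕ → List (Fin d), ArnouxRauzy.IsBispecialEnumeration u B) ∧
    ∀ B : ℕ → List (Fin d), ArnouxRauzy.IsBispecialEnumeration u B →
      ∀ n : ℕ, 1 ≤ n →
        (∃! k : ℕ, 1 ≤ k ∧ (B (k - 1)).length < n ∧ n ≤ (B k).length) ∧
        ∀ k : ℕ, 1 ≤ k → (B (k - 1)).length < n → n ≤ (B k).length →
          IsGreatest (ArnouxRauzy.initialNonRepetitive u n) (ArnouxRauzy.inrC u n) ∧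
          ArnouxRauzy.inrC u n = (ArnouxRauzy.directiveMorphism i k [i k]).length ∧
          ∃ r : List (Fin d),
            ArnouxRauzy.IsFirstReturnWord u (ArnouxRauzy.factorAt u 0 n) r ∧
            r.length = ArnouxRauzy.inrC u n := by
  have hB := hi.isBispecialEnumeration
  refine ⟨⟨_, hB⟩, fun B hB' n hn => ⟨?_, fun k hk h1 h2 => ?_⟩⟩
  · refine ArnouxRauzy.existsUnique_between_of_strictMono hB'.strictMono_length ?_ hn
    exact hB'.length_unique hB 0
  · obtain ⟨k, rfl⟩ := Nat.exists_eq_add_of_le' hk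
    rw [Nat.add_sub_cancel] at h1
    rw [hB'.length_unique hB] at h1 h2
    have hret := hi.consecutiveOccurrences_prefix h1 h2
    have hgr := ArnouxRauzy.isGreatest_initialNonRepetitive (fun _ => hu.eq_prefix) hret
    -- The greatest element makes `sSup` a true maximum, not the default 0 of an unbounded set.
    have hinr : ArnouxRauzy.inrC u n = _ := hgr.csSup_eq
    rw [hinr]
    exact ⟨hgr, rfl, _, ⟨0, _, hret, fun l hl => absurd hl (Nat.not_lt_zero l), rfl⟩, by simp⟩
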